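/- **Setting (non-preemptive machine replenishment).** There are finitely many independent machines. Machine $i$ has a finite set $\mathcal S_i$ of active states with transition probabilities $p_{uv}$, rewards $r_u\ge 0$, repair costs $c_u\ge 0$, an initial active state $\rho_i$, and a repair success probability $s_i\in(0,1]$. At the beginning of each time slot a scheduling policy (which may be randomized and may depend on the whole history) may move any active machine $i$, in state $u$, to the repair queue at cost $c_u$, and may start the repair of machines in the queue (including those just moved), as long as at most $M$ machines are then under repair. A repair that has been started cannot be interrupted; in each slot in which machine $i$ is under repair, the repair completes at the end of the slot with probability $s_i$, independently of everything else, and then the machine begins the next slot in state $\rho_i$. A machine that is active in state $u$ during a slot earns $r_u$ and begins the next slot in state $v$ with probability $p_{uv}$; a machine in the repair queue earns nothing. All machines start in their initial active states, and the value of a policy is its expected long-run time-average reward minus cost. The optimal value is the supremum of the values of all policies (with $\limsup$ averages). The *Whittle index* of a state $u\in\mathcal S_i$ is the largest penalty $\lambda\in\mathbb R$ per step of maintenance for which an average-optimal policy for machine $i$ alone (reward minus cost, minus $\lambda$ for each slot under repair, where a machine sent to the queue is worked on at once and until its repair completes) still sends the machine to repair in state $u$. The *Whittle index policy* gives, at the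 beginning of every slot, the free repair capacity (after machines already waiting in the queue, if any) to the active machines of highest index among those of non-negative index, ties being broken arbitrarily. **Theorem.** For $n\ge 2$ consider the instance with $M=1$ and two machines $i\in\{1,2\}$, where $\mathcal S_i=\{\rho_i,b_i\}$, $r_{\rho_i}=1$, $r_{b_i}=0$, all costs are $0$, machine $i$ in state $\rho_i$ moves to $b_i$ with probability $p_i$ per slot, $b_i$ is left only through repair, and $$p_1=\frac1n,\qquad s_1=\frac1{n^4},\qquad p_2=s_2=1 .$$ There is a constant $C>0$ such that for every $n\ge 2$: 1. the optimal value is $\tfrac12$, and some policy has time-average reward (as a limit) equal to $\tfrac12$; 2. Whittle index policies exist, and each of them has a time-average reward $w$ (as a limit) with $0<w\le C/n^3$. Consequently the Whittle index policy is an arbitrarily poor approximation for non-preemptive machine replenishment even with two machines and $M=1$: for every $\alpha\in\mathbb R$ there is $n\ge 2$ such that, on this instance, $\alpha$ times the value of any Whittle index policy is less than the optimal value. -/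

import Mathlib

open Filter Topology

/-! ### Finite Markov decision processes and the long-run average reward -/

/-- A Markov decision process with finitely many states and actions: `allowed x a` says that the
action `a` may be taken in state `x`, `trans x a y` is the probability of moving to `y`. -/
structure MDP (X A : Type) [Fintype X] [Fintype A] where
  allowed : X → A → Prop
  exists_allowed : ∀ x, ∃ a, allowed x a
  reward : X → A → ℝ
  trans : X → A → X → ℝ
  trans_nonneg : ∀ x a y, 0 ≤ trans x a y
  trans_sum : ∀ x a, ∑ y, trans x a y = 1

namespace MDP

variable {X A : Type} [Fintype X] [Fintype A]

/-- A policy may be randomized and may depend on the whole history (the list of past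
state-action pairs, the most recent one first) and on the current state.  `prob h x a` is the
probability of choosing the action `a`. -/
structure Policy (D : MDP X A) where
  prob : List (X × A) → X → A → ℝ
  prob_nonneg : ∀ h x a, 0 ≤ prob h x a
  prob_sum : ∀ h x, ∑ a, prob h x a = 1
  prob_allowed : ∀ h x a, prob h x a ≠ 0 → D.allowed x a

/-- The expected total reward over the next `N` steps, given the history `h` and the current
state `x`. -/
def expTotal (D : MDP X A) (π : D.Policy) : ℕ → List (X × A) → X → ℝ
  | 0, _, _ => 0
  | N + 1, h, x =>
      ∑ a, π.prob h x a *
        (D.reward x a + ∑ y, D.trans x a y * expTotal D π N ((x, a) :: h) y)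

/-- The expected average reward per step over the first `N` steps, started in `x`. -/
noncomputable def finiteAverage (D : MDP X A) (π : D.Policy) (x : X) (N : ℕ) : ℝ :=
  D.expTotal π N [] x / N

/-- The time-average reward of the policy `π` started in `x` exists and equals `g`. -/
def HasAverage (D : MDP X A) (π : D.Policy) (x : X) (g : ℝ) : Prop :=
  Tendsto (D.finiteAverage π x) atTop (𝓝 g)

noncomputable def upperAverage (D : MDP X A) (π : D.Policy) (x : X) : ℝ :=
  limsup (D.finiteAverage π x) atTop

noncomputable def lowerAverage (D : MDP X A) (π : D.Policy) (x : X) : ℝ :=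
  liminf (D.finiteAverage π x) atTop

/-- The optimal time-average reward from `x`: the supremum over all policies. -/
noncomputable def optimalAverage (D : MDP X A) (x : X) : ℝ :=
  ⨆ π : D.Policy, D.upperAverage π x

/-- A policy is average optimal if, from every starting state, no policy does better. -/
def IsAverageOptimal (D : MDP X A) (σ : D.Policy) : Prop :=
  ∀ x, ∀ π : D.Policy, D.upperAverage π x ≤ D.lowerAverage σ x

/-- The stationary deterministic policy given by a decision rule. -/
def stationary [DecidableEq A] (D : MDP X A) (f : X → A) (hf : ∀ x, D.allowed x (f x)) :
    D.Policy where
  prob _ x a := if a = f x then 1 else 0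
  prob_nonneg _ _ _ := by split_ifs <;> norm_num
  prob_sum _ _ := by simp
  prob_allowed _ x a h := by
    have h1 : a = f x := by
      by_contra hne
      simp [hne] at h
    rw [h1]
    exact hf x

end MDP

/-! ### Machines -/

/-- A machine with set `S` of active states: transition probabilities `p`, rewards `r` per time
step, costs `c` for being sent to repair, success probability `s` of the geometric repair time,
and the initial active state `init`, to which the machine returns after a repair. -/
structure Machine (S : Type) [Fintype S] where
  p : S → S → ℝ
  p_nonneg : ∀ u v, 0 ≤ p u v
  p_sum : ∀ u, ∑ v, p u v = 1
  r : S → ℝ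
  r_nonneg : ∀ u, 0 ≤ r u
  c : S → ℝ
  c_nonneg : ∀ u, 0 ≤ c u
  s : ℝ
  s_pos : 0 < s
  s_le_one : s ≤ 1
  init : S

/-- The status of a machine: in an active state, in the repair queue with its repair not yet
started, or in the repair queue with its repair under way. -/
inductive Status (S : Type) where
  | active (u : S)
  | waiting
  | serving
  deriving DecidableEq, Fintype

/-- What a scheduling policy may decide for a machine at the beginning of a time slot: leave it
alone; move it to the repair queue, where it waits; or start its repair (moving it to the repair
queue first, if it is still active). -/
inductive Decision where
  | keep
  | enqueue
  | repair
  deriving DecidableEq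

instance : Fintype Decision where
  elems := {.keep, .enqueue, .repair}
  complete x := by cases x <;> simp

namespace Status

variable {S : Type}

/-- The status during the time slot, after the decision has been carried out.  A repair that is
under way goes on whatever the decision: repairs are non-preemptive. -/
def after : Status S → Decision → Status S
  | active u, .keep => active u
  | active _, .enqueue => waiting
  | active _, .repair => serving
  | waiting, .repair => serving
  | waiting, _ => waiting
  | serving, _ => serving

def isServing : Status S → Bool
  | serving => true
  | _ => false

end Status

namespace Machine

variable {S : Type} [Fintype S]

/-- The reward of a time slot minus the cost of moving the machine to the repair queue.  Only a
machine that stays active earns a reward. -/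
def slotReward (m : Machine S) : Status S → Decision → ℝ
  | .active u, .keep => m.r u
  | .active u, _ => -m.c u
  | _, _ => 0

/-- The probability that a machine with status `z` during a time slot has status `y` at the
beginning of the next one. -/
def step [DecidableEq S] (m : Machine S) : Status S → Status S → ℝ
  | .active u, .active v => m.p u v
  | .active _, _ => 0
  | .waiting, .waiting => 1
  | .waiting, _ => 0
  | .serving, .active v => if v = m.init then m.s else 0
  | .serving, .serving => 1 - m.s
  | .serving, .waiting => 0

theorem step_nonneg [DecidableEq S] (m : Machine S) (z y : Status S) : 0 ≤ m.step z y := by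
  have h1 := m.s_pos
  have h2 := m.s_le_one
  cases z <;> cases y <;> simp only [step]
  case active.active u v => exact m.p_nonneg u v
  case serving.active v => split_ifs <;> linarith
  case serving.serving => linarith
  all_goals norm_num

theorem sum_status (f : Status S → ℝ) :
    ∑ y, f y = (∑ v, f (.active v)) + f .waiting + f .serving := by
  let e : S ⊕ Bool ≃ Status S :=
    { toFun := fun y => match y with
        | .inl u => .active u
        | .inr false => .waiting
        | .inr true => .serving
      invFun := fun y => match y with
        | .active u => Sum.inl u
        | .waiting => Sum.inr false
        | .serving => Sum.inr true
      left_inv := by rintro (u | (_ | _)) <;> rfl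
      right_inv := by intro y; cases y <;> rfl }
  rw [← Equiv.sum_comp e f, Fintype.sum_sum_type, Fintype.sum_bool]
  simp only [e, Equiv.coe_fn_mk]
  ring

theorem step_sum [DecidableEq S] (m : Machine S) (z : Status S) : ∑ y, m.step z y = 1 := by
  rw [sum_status]
  cases z <;> simp [step, m.p_sum]

/-- The single-machine problem with penalty `pen` per maintenance step: the machine has the
repair facility for itself, so that its repair starts as soon as it is sent to the repair queue,
and `pen` is charged in every time slot in which it is under repair. -/
def penaltyMDP [DecidableEq S] (m : Machine S) (pen : ℝ) : MDP (Status S) Decision where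
  allowed x a := x.after a ≠ .waiting
  exists_allowed x := ⟨.repair, by cases x <;> simp [Status.after]⟩
  reward x a := m.slotReward x a - if (x.after a).isServing then pen else 0
  trans x a y := m.step (x.after a) y
  trans_nonneg x a y := m.step_nonneg _ y
  trans_sum x a := m.step_sum _

/-- The Whittle index of the active state `u`: the largest penalty per maintenance step for which
an optimal single-machine policy still sends the machine to maintenance in state `u`. -/
noncomputable def whittleIndex [DecidableEq S] (m : Machine S) (u : S) : EReal :=
  sSup ((fun pen : ℝ => (pen : EReal)) ''
    {pen : ℝ | ∃ (f : Status S → Decision) (hf : ∀ x, (m.penaltyMDP pen).allowed x (f x)),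
      (m.penaltyMDP pen).IsAverageOptimal ((m.penaltyMDP pen).stationary f hf) ∧
        f (.active u) = .repair})

end Machine

/-! ### Non-preemptive machine replenishment -/

section Replenishment

variable {ι : Type} [Fintype ι] [DecidableEq ι] {S : ι → Type} [∀ i, Fintype (S i)]
  [∀ i, DecidableEq (S i)]

/-- The number of machines under repair. -/
def numServing (z : ∀ i, Status (S i)) : ℕ :=
  (Finset.univ.filter fun i => (z i).isServing = true).card

/-- The status of all machines during the time slot, after the decisions. -/
def afterAll (x : ∀ i, Status (S i)) (a : ι → Decision) : ∀ i, Status (S i) :=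
  fun i => (x i).after (a i)

/-- Machine replenishment with independent machines `m i`, when at most `M` machines can be under
repair at any time: new repairs may be started only if at most `M` are then under way. -/
def replenishment (m : ∀ i, Machine (S i)) (M : ℕ) :
    MDP (∀ i, Status (S i)) (ι → Decision) where
  allowed x a :=
    (∃ i, (x i).isServing = false ∧ ((x i).after (a i)).isServing = true) →
      numServing (afterAll x a) ≤ M
  exists_allowed x := ⟨fun _ => .keep, by
    rintro ⟨i, h1, h2⟩
    exfalso
    revert h1 h2
    cases x i <;> simp [Status.after, Status.isServing]⟩
  reward x a := ∑ i, (m i).slotReward (x i) (a i)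
  trans x a y := ∏ i, (m i).step ((x i).after (a i)) (y i)
  trans_nonneg x a y := Finset.prod_nonneg fun i _ => (m i).step_nonneg _ _
  trans_sum x a := by
    have h := Finset.prod_univ_sum (fun i : ι => (Finset.univ : Finset (Status (S i))))
      (fun i y => (m i).step ((x i).after (a i)) y)
    rw [Fintype.piFinset_univ] at h
    rw [← h]
    exact Finset.prod_eq_one fun i _ => (m i).step_sum _

/-- All machines are in their initial active state. -/
def allInitial (m : ∀ i, Machine (S i)) : ∀ i, Status (S i) :=
  fun i => .active (m i).init

/-- The decisions `a` in the joint state `x` follow the Whittle indices: whenever the repair of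
fewer than `M` machines is under way, the free capacity is given to the active machines of
highest index among those of non-negative index (after machines already waiting in the queue, if
there are any).  Ties may be broken arbitrarily. -/
structure IsWhittleAction (m : ∀ i, Machine (S i)) (M : ℕ) (x : ∀ i, Status (S i))
    (a : ι → Decision) : Prop where
  allowed : (replenishment m M).allowed x a
  not_enqueue : ∀ i, a i ≠ .enqueue
  index_nonneg : ∀ i u, x i = .active u → a i = .repair → 0 ≤ (m i).whittleIndex u
  highest : ∀ i u j v, x i = .active u → a i = .repair → x j = .active v → a j ≠ .repair →
    (m j).whittleIndex v ≤ (m i).whittleIndex u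
  no_idling : ∀ j v, x j = .active v → 0 ≤ (m j).whittleIndex v → a j ≠ .repair →
    M ≤ numServing (afterAll x a)
  waiting_no_idling : ∀ j, x j = .waiting → a j ≠ .repair → M ≤ numServing (afterAll x a)
  waiting_first : ∀ j, x j = .waiting → a j ≠ .repair → ∀ i u, x i = .active u → a i ≠ .repair

/-- A Whittle index policy: all its choices, in every situation, follow the Whittle indices. -/
def IsWhittlePolicy (m : ∀ i, Machine (S i)) (M : ℕ) (π : (replenishment m M).Policy) : Prop :=
  ∀ h x a, π.prob h x a ≠ 0 → IsWhittleAction m M x a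

end Replenishment

/-! ### The instances -/

/-- The active states of a machine that is either good or broken. -/
inductive Cond where
  | good
  | broken
  deriving DecidableEq

instance : Fintype Cond where
  elems := {.good, .broken}
  complete x := by cases x <;> simp

/-- A machine that earns `1` per time step while good, breaks with probability `q` per step,
earns nothing once broken, stays broken until repaired, and can be sent to repair for free. -/
def twoStateMachine (q s : ℝ) (hq0 : 0 ≤ q) (hq1 : q ≤ 1) (hs0 : 0 < s) (hs1 : s ≤ 1) :
    Machine Cond where
  p u v := match u, v with
    | .good, .good => 1 - q
    | .good, .broken => q
    | .broken, .good => 0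
    | .broken, .broken => 1
  p_nonneg u v := by
    cases u <;> cases v <;> simp only <;> linarith
  p_sum u := by
    have h : (Finset.univ : Finset Cond) = {.good, .broken} := by decide
    cases u <;> simp [h]
  r u := match u with
    | .good => 1
    | .broken => 0
  r_nonneg u := by cases u <;> simp
  c _ := 0
  c_nonneg _ := le_refl _
  s := s
  s_pos := hs0
  s_le_one := hs1
  init := .good

/-- Two machines: the first breaks with probability `1 / n` per step and its repair ends with
probability `1 / n ^ 4` per step; the second always breaks after one step, and its repair always
takes one step. -/
noncomputable def gapMachines (n : ℕ) (hn : 2 ≤ n) : Fin 2 → Machine Cond :=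
  have h1 : (1 : ℝ) ≤ n := by exact_mod_cast (by omega : 1 ≤ n)
  ![twoStateMachine (1 / n) (1 / n ^ 4) (by positivity)
      (by rw [div_le_one (by linarith)]; exact h1) (by positivity)
      (by rw [div_le_one (by positivity)]; exact one_le_pow₀ h1),
    twoStateMachine 1 1 zero_le_one le_rfl zero_lt_one le_rfl]

/-! The trap is the non-preemptive repair of the first machine. Index order is harmless when both
machines are broken: a broken state has index `s / q`, which is `1 / n ^ 3` for the first machine
and `1` for the second, so the second is repaired. One slot later it is good, good states have
negative index, and the free capacity must go to the broken first machine. That repair blocks the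
facility for `n ^ 4` slots on average while the second machine lies broken, and it buys only about
`n` good slots. A cycle thus earns order `n` over order `n ^ 3` times as many slots. Ignoring the
first machine and alternating on the second earns `1 / 2`.

All averages come from potentials: if reward plus expected next potential equals (or is at most) `g`
plus the current potential, telescoping makes the average equal to (or at most) `g`.
`whittleIndex_good_le` and `whittleIndex_broken` give the indices, `gapMachines_upperAverage_le` the
optimality bound, `IsWhittleAction.after_eq` the forced decisions, and
`IsWhittlePolicy.hasAverage_gapMachines` the resulting average. -/

namespace MDP

/-! ### Average rewards from potentials -/

variable {X A : Type} [Fintype X] [Fintype A]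

/-- The one-step inequality telescopes along the horizon. The factor `c` is there to be `1` or `-1`,
so that one induction yields both upper and lower bounds; `I` is a set of states that the policy
never leaves. -/
theorem mul_expTotal_le (D : MDP X A) (π : D.Policy) (I : X → Prop) (v : X → ℝ) (c g K : ℝ)
    (hI : ∀ h x a y, I x → π.prob h x a ≠ 0 → D.trans x a y ≠ 0 → I y)
    (hv : ∀ h x a, I x → π.prob h x a ≠ 0 →
      c * D.reward x a + ∑ y, D.trans x a y * v y ≤ g + v x)
    (hK : ∀ x, -K ≤ v x) (N : ℕ) :
    ∀ h x, I x → c * D.expTotal π N h x ≤ N * g + v x + K := by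
  induction N with
  | zero =>
    intro h x _
    simp only [expTotal]
    push_cast
    linarith [hK x]
  | succ N ih =>
    intro h x hx
    have key : ∀ a, π.prob h x a * (c * (D.reward x a +
        ∑ y, D.trans x a y * D.expTotal π N ((x, a) :: h) y)) ≤
        π.prob h x a * (((N + 1 : ℕ) : ℝ) * g + v x + K) := by
      intro a
      by_cases h0 : π.prob h x a = 0
      · simp [h0]
      refine mul_le_mul_of_nonneg_left ?_ (π.prob_nonneg h x a)
      have h1 : ∑ y, D.trans x a y * (c * D.expTotal π N ((x, a) :: h) y) ≤
          ∑ y, D.trans x a y * (N * g + v y + K) := by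
        refine Finset.sum_le_sum fun y _ => ?_
        by_cases hy : D.trans x a y = 0
        · simp [hy]
        · exact mul_le_mul_of_nonneg_left (ih _ y (hI h x a y hx h0 hy)) (D.trans_nonneg x a y)
      have h2 : ∑ y, D.trans x a y * (N * g + v y + K) =
          (∑ y, D.trans x a y * v y) + (N * g + K) := by
        have : ∀ y, D.trans x a y * (N * g + v y + K) =
            D.trans x a y * v y + D.trans x a y * (N * g + K) := fun y => by ring
        simp only [this, Finset.sum_add_distrib, ← Finset.sum_mul, D.trans_sum, one_mul]
      have h3 : c * ∑ y, D.trans x a y * D.expTotal π N ((x, a) :: h) y =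
          ∑ y, D.trans x a y * (c * D.expTotal π N ((x, a) :: h) y) := by
        rw [Finset.mul_sum]
        exact Finset.sum_congr rfl fun y _ => by ring
      have h4 := hv h x a hx h0
      push_cast
      rw [mul_add, h3]
      linarith
    calc c * D.expTotal π (N + 1) h x
        = ∑ a, π.prob h x a * (c * (D.reward x a +
            ∑ y, D.trans x a y * D.expTotal π N ((x, a) :: h) y)) := by
          rw [expTotal, Finset.mul_sum]
          exact Finset.sum_congr rfl fun a _ => by ring
      _ ≤ ∑ a, π.prob h x a * (((N + 1 : ℕ) : ℝ) * g + v x + K) :=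
          Finset.sum_le_sum fun a _ => key a
      _ = _ := by rw [← Finset.sum_mul, π.prob_sum, one_mul]

theorem exists_mul_finiteAverage_le (D : MDP X A) (π : D.Policy) (I : X → Prop) (v : X → ℝ)
    (c g : ℝ) (hI : ∀ h x a y, I x → π.prob h x a ≠ 0 → D.trans x a y ≠ 0 → I y)
    (hv : ∀ h x a, I x → π.prob h x a ≠ 0 →
      c * D.reward x a + ∑ y, D.trans x a y * v y ≤ g + v x) {x : X} (hx : I x) :
    ∃ K : ℝ, ∀ᶠ N : ℕ in atTop, c * D.finiteAverage π x N ≤ g + K / N := by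
  have hK : ∀ y, -(∑ z, |v z|) ≤ v y := fun y => by
    have := Finset.single_le_sum (f := fun z => |v z|) (fun z _ => abs_nonneg _)
      (Finset.mem_univ y)
    linarith [neg_abs_le (v y)]
  refine ⟨v x + ∑ z, |v z|, ?_⟩
  filter_upwards [eventually_gt_atTop 0] with N hN
  have hN' : (0 : ℝ) < N := by exact_mod_cast hN
  have h := D.mul_expTotal_le π I v c g _ hI hv hK N [] x hx
  rw [finiteAverage, ← mul_div_assoc, div_le_iff₀ hN', add_mul, div_mul_cancel₀ _ hN'.ne']
  linarith

theorem tendsto_add_div_natCast (g K : ℝ) :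
    Tendsto (fun N : ℕ => g + K / (N : ℝ)) atTop (𝓝 g) := by
  simpa using (tendsto_const_nhds (x := g)).add (tendsto_const_div_atTop_nhds_zero_nat K)

/-- A potential that certifies the upper bound `g` for every allowed action. -/
theorem upperAverage_le (D : MDP X A) (π : D.Policy) (v : X → ℝ) (g : ℝ)
    (hv : ∀ x a, D.allowed x a → D.reward x a + ∑ y, D.trans x a y * v y ≤ g + v x) (x : X) :
    D.upperAverage π x ≤ g := by
  obtain ⟨K, hK⟩ := D.exists_mul_finiteAverage_le π (fun _ => True) v 1 g
    (fun _ _ _ _ _ _ _ => trivial)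
    (fun h x a _ h0 => by simpa using hv x a (π.prob_allowed h x a h0)) (x := x) trivial
  -- A crude lower bound on the averages, from zero potential and the sum of all absolute rewards:
  -- comparing real limsups requires the sequence not to drift to minus infinity.
  obtain ⟨K', hK'⟩ := D.exists_mul_finiteAverage_le π (fun _ => True) (fun _ => 0) (-1)
    (∑ x, ∑ a, |D.reward x a|) (fun _ _ _ _ _ _ _ => trivial)
    (fun h x a _ h0 => by
      have h1 := Finset.single_le_sum (f := fun a => |D.reward x a|) (fun z _ => abs_nonneg _)
        (Finset.mem_univ a)
      have h2 := Finset.single_le_sum (f := fun x => ∑ a, |D.reward x a|)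
        (fun z _ => Finset.sum_nonneg fun _ _ => abs_nonneg _) (Finset.mem_univ x)
      simp only [mul_zero, Finset.sum_const_zero, add_zero]
      linarith [neg_abs_le (D.reward x a)]) (x := x) trivial
  have ht := tendsto_add_div_natCast g K
  rw [upperAverage, ← ht.limsup_eq]
  refine limsup_le_limsup ?_ ?_ ht.isBoundedUnder_le
  · filter_upwards [hK] with N h
    simpa using h
  · have ht' := (tendsto_add_div_natCast (∑ x, ∑ a, |D.reward x a|) K').neg
    refine IsBoundedUnder.isCoboundedUnder_le ?_
    refine ht'.isBoundedUnder_ge.mono_ge ?_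
    filter_upwards [hK'] with N h
    linarith

/-- A solution of the evaluation equation on a set that the policy does not leave. -/
theorem hasAverage_of_potential (D : MDP X A) (π : D.Policy) (I : X → Prop) (v : X → ℝ) (g : ℝ)
    (hI : ∀ h x a y, I x → π.prob h x a ≠ 0 → D.trans x a y ≠ 0 → I y)
    (hv : ∀ h x a, I x → π.prob h x a ≠ 0 →
      D.reward x a + ∑ y, D.trans x a y * v y = g + v x) {x : X} (hx : I x) :
    D.HasAverage π x g := by
  obtain ⟨K, hK⟩ := D.exists_mul_finiteAverage_le π I v 1 g hI
    (fun h x a hx h0 => by simpa using (hv h x a hx h0).le) hx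
  obtain ⟨K', hK'⟩ := D.exists_mul_finiteAverage_le π I (fun y => -v y) (-1) (-g) hI
    (fun h x a hx h0 => by
      have := hv h x a hx h0
      simp only [mul_neg, Finset.sum_neg_distrib]
      linarith) hx
  have ht' := (tendsto_add_div_natCast (-g) K').neg
  rw [neg_neg] at ht'
  refine tendsto_of_tendsto_of_tendsto_of_le_of_le' ht' (tendsto_add_div_natCast g K) ?_ ?_
  · filter_upwards [hK'] with N h
    linarith
  · filter_upwards [hK] with N h
    linarith

theorem hasAverage_stationary [DecidableEq A] (D : MDP X A) (f : X → A)
    (hf : ∀ x, D.allowed x (f x)) (I : X → Prop) (v : X → ℝ) (g : ℝ)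
    (hI : ∀ x y, I x → D.trans x (f x) y ≠ 0 → I y)
    (hv : ∀ x, I x → D.reward x (f x) + ∑ y, D.trans x (f x) y * v y = g + v x)
    {x : X} (hx : I x) : D.HasAverage (D.stationary f hf) x g := by
  have hs : ∀ h x a, (D.stationary f hf).prob h x a ≠ 0 → a = f x := by
    intro h x a h0
    by_contra hne
    simp [stationary, hne] at h0
  refine D.hasAverage_of_potential _ I v g ?_ ?_ hx
  · intro h x a y hx h0 hy
    rw [hs h x a h0] at hy
    exact hI x y hx hy
  · intro h x a hx h0
    rw [hs h x a h0]
    exact hv x hx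

theorem IsAverageOptimal.le_of_hasAverage {D : MDP X A} {σ π : D.Policy} {x : X} {g g' : ℝ}
    (h : D.IsAverageOptimal σ) (hσ : D.HasAverage σ x g) (hπ : D.HasAverage π x g') : g' ≤ g := by
  have := h x π
  rwa [upperAverage, lowerAverage, hπ.limsup_eq, hσ.liminf_eq] at this

end MDP

/-! ### One-step expectations for a single machine -/

namespace Machine

variable {S : Type} [Fintype S] [DecidableEq S]

/-- The expectation of `f` over the next status, given the status `z` during the slot. -/
def expNext (m : Machine S) (z : Status S) (f : Status S → ℝ) : ℝ :=
  match z with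
  | .active u => ∑ v, m.p u v * f (.active v)
  | .waiting => f .waiting
  | .serving => m.s * f (.active m.init) + (1 - m.s) * f .serving

theorem sum_step_mul (m : Machine S) (z : Status S) (f : Status S → ℝ) :
    ∑ y, m.step z y * f y = m.expNext z f := by
  rw [sum_status]
  cases z <;> simp [step, expNext]

end Machine

theorem Cond.sum_eq (f : Cond → ℝ) : ∑ u, f u = f .good + f .broken := by
  have h : (Finset.univ : Finset Cond) = {.good, .broken} := by decide
  simp [h]

theorem eq_repair_of_allowed_waiting {m : Machine Cond} {pen : ℝ} {d : Decision}
    (h : (m.penaltyMDP pen).allowed .waiting d) : d = .repair := by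
  cases d <;> simp_all [Machine.penaltyMDP, Status.after]

/-! ### Whittle indices of a two-state machine -/

section TwoState

variable (q s : ℝ) (hq0 : 0 ≤ q) (hq1 : q ≤ 1) (hs0 : 0 < s) (hs1 : s ≤ 1)

/-- Run the machine while it is good and repair it otherwise. -/
def repairBroken : Status Cond → Decision
  | .active .good => .keep
  | _ => .repair

theorem hasAverage_keep_repair (hq : 0 < q) (pen : ℝ) (f : Status Cond → Decision)
    (hf : ∀ x, ((twoStateMachine q s hq0 hq1 hs0 hs1).penaltyMDP pen).allowed x (f x))
    (hg : f (.active .good) = .keep) (hb : f (.active .broken) = .repair) (x : Status Cond) :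
    ((twoStateMachine q s hq0 hq1 hs0 hs1).penaltyMDP pen).HasAverage
      (((twoStateMachine q s hq0 hq1 hs0 hs1).penaltyMDP pen).stationary f hf) x
      ((s - pen * q) / (q + s)) := by
  have hqs : q + s ≠ 0 := by positivity
  have hw := eq_repair_of_allowed_waiting (hf .waiting)
  refine MDP.hasAverage_stationary _ _ hf (fun _ => True)
    -- All non-good statuses lead to service at once, so they share the value `0`; the value `h` of
    -- good solves `1 - q * h = g` and `s * h - pen = g`.
    (fun y => if y = .active .good then (1 + pen) / (q + s) else 0) _ (fun _ _ _ _ => trivial)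
    (fun x _ => ?_) trivial
  simp only [Machine.penaltyMDP, Machine.sum_step_mul]
  rcases x with (_ | _) | _ | _ <;>
    simp [hg, hb, hw, Status.after, Status.isServing, Machine.expNext, Machine.slotReward,
      twoStateMachine] <;> field_simp <;> ring

theorem hasAverage_keep (pen : ℝ) (f : Status Cond → Decision)
    (hf : ∀ x, ((twoStateMachine q s hq0 hq1 hs0 hs1).penaltyMDP pen).allowed x (f x))
    (hb : f (.active .broken) = .keep) :
    ((twoStateMachine q s hq0 hq1 hs0 hs1).penaltyMDP pen).HasAverage
      (((twoStateMachine q s hq0 hq1 hs0 hs1).penaltyMDP pen).stationary f hf)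
      (.active .broken) 0 := by
  refine MDP.hasAverage_stationary _ _ hf (fun y => y = .active .broken)
    (fun _ => 0) _ ?_ ?_ rfl
  · rintro x y rfl h
    rcases y with (_ | _) | _ | _ <;>
      simp_all [Machine.penaltyMDP, Machine.step, Status.after, twoStateMachine]
  · rintro x rfl
    simp [Machine.penaltyMDP, hb, Status.after, Status.isServing, Machine.slotReward,
      twoStateMachine]

/-- The machine is returned to repair as soon as it comes back good, so every slot costs `pen`. The
condition on `x` excludes starting in a broken state that is never left. -/
theorem hasAverage_repair_good (pen : ℝ) (f : Status Cond → Decision)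
    (hf : ∀ x, ((twoStateMachine q s hq0 hq1 hs0 hs1).penaltyMDP pen).allowed x (f x))
    (hg : f (.active .good) = .repair) (x : Status Cond)
    (hx : x = .active .broken → f (.active .broken) = .repair) :
    ((twoStateMachine q s hq0 hq1 hs0 hs1).penaltyMDP pen).HasAverage
      (((twoStateMachine q s hq0 hq1 hs0 hs1).penaltyMDP pen).stationary f hf) x (-pen) := by
  refine MDP.hasAverage_stationary _ _ hf
    (fun y => y = .active .broken → f (.active .broken) = .repair) (fun _ => 0) _ ?_ ?_ hx
  · rintro x y hx h rfl
    have hw := eq_repair_of_allowed_waiting (hf .waiting)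
    rcases x with (_ | _) | _ | _ <;>
      simp_all [Machine.penaltyMDP, Machine.step, Status.after, twoStateMachine]
  · intro x hx
    rcases x with (_ | _) | _ | _
    · simp [Machine.penaltyMDP, hg, Status.after, Status.isServing, Machine.slotReward,
        twoStateMachine]
    · simp [Machine.penaltyMDP, hx rfl, Status.after, Status.isServing, Machine.slotReward,
        twoStateMachine]
    · have hw := eq_repair_of_allowed_waiting (hf .waiting)
      simp [Machine.penaltyMDP, hw, Status.after, Status.isServing, Machine.slotReward]
    · simp [Machine.penaltyMDP, Status.after, Status.isServing, Machine.slotReward]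

theorem allowed_repairBroken (m : Machine Cond) (pen : ℝ) (x : Status Cond) :
    (m.penaltyMDP pen).allowed x (repairBroken x) := by
  rcases x with (_ | _) | _ | _ <;> simp [Machine.penaltyMDP, repairBroken, Status.after]

/-- Repairing a good machine yields `-pen`, and optimality forces this to be at least `(s - pen * q)
/ (q + s)`, the average of repairing only when broken; that means `pen ≤ -1`. -/
theorem whittleIndex_good_le (hq : 0 < q) :
    (twoStateMachine q s hq0 hq1 hs0 hs1).whittleIndex .good ≤ ((-1 : ℝ) : EReal) := by
  refine sSup_le ?_
  rintro _ ⟨pen, ⟨f, hf, hopt, hg⟩, rfl⟩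
  refine EReal.coe_le_coe_iff.2 ?_
  have h := hopt.le_of_hasAverage
    (hasAverage_repair_good q s hq0 hq1 hs0 hs1 pen f hf hg (.active .good) (by simp))
    (hasAverage_keep_repair q s hq0 hq1 hs0 hs1 hq pen _ (allowed_repairBroken _ pen) rfl rfl _)
  rw [div_le_iff₀ (by positivity)] at h
  nlinarith

/-- The break-even penalty: a cycle earns `1 / q` in expectation and is charged for `1 / s` slots of
repair, so at `pen = s / q` repairing averages `0`, exactly as staying broken does. -/
theorem whittleIndex_broken (hq : 0 < q) :
    (twoStateMachine q s hq0 hq1 hs0 hs1).whittleIndex .broken = ((s / q : ℝ) : EReal) := by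
  refine le_antisymm (sSup_le ?_) (le_sSup ⟨s / q, ⟨repairBroken, allowed_repairBroken _ _,
    fun x π => ?_, rfl⟩, rfl⟩)
  · rintro _ ⟨pen, ⟨f, hf, hopt, hb⟩, rfl⟩
    refine EReal.coe_le_coe_iff.2 ?_
    -- The competitor stays broken and averages `0` from there; its other choices only have to be
    -- allowed.
    let k : Status Cond → Decision := fun x => if x = .active .broken then .keep else .repair
    have hk : ∀ x, ((twoStateMachine q s hq0 hq1 hs0 hs1).penaltyMDP pen).allowed x (k x) := by
      intro x
      rcases x with (_ | _) | _ | _ <;> simp [Machine.penaltyMDP, k, Status.after]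
    have h0 := hasAverage_keep q s hq0 hq1 hs0 hs1 pen k hk (by simp [k])
    cases hg : f (.active .good) with
    | keep =>
      have h := hopt.le_of_hasAverage
        (hasAverage_keep_repair q s hq0 hq1 hs0 hs1 hq pen f hf hg hb (.active .broken)) h0
      rw [le_div_iff₀ (by positivity)] at h
      rw [le_div_iff₀ hq]
      linarith
    | enqueue =>
      have := hf (.active .good)
      simp [Machine.penaltyMDP, hg, Status.after] at this
    | repair =>
      have h := hopt.le_of_hasAverage
        (hasAverage_repair_good q s hq0 hq1 hs0 hs1 pen f hf hg (.active .broken) fun _ => hb) h0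
      have : 0 < s / q := by positivity
      linarith
  · have h1 := (hasAverage_keep_repair q s hq0 hq1 hs0 hs1 hq (s / q) _
      (allowed_repairBroken _ _) rfl rfl x).liminf_eq
    rw [MDP.lowerAverage, h1, div_mul_cancel₀ _ hq.ne', sub_self, zero_div]
    refine MDP.upperAverage_le _ π (fun y => if y = .active .good then 1 / q else 0) 0 ?_ x
    intro x a ha
    simp only [Machine.penaltyMDP, Machine.sum_step_mul] at ha ⊢
    have : 0 < q⁻¹ := by positivity
    rcases x with (_ | _) | _ | _ <;> cases a <;>
      simp [Status.after, Status.isServing, Machine.expNext, Machine.slotReward,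
        twoStateMachine] at ha ⊢ <;> field_simp <;> linarith

end TwoState

/-! ### Two machines sharing one repair slot -/

section TwoMachines

variable {m : Fin 2 → Machine Cond}

theorem numServing_fin_two (z : Fin 2 → Status Cond) :
    numServing z = (if z 0 = .serving then 1 else 0) + if z 1 = .serving then 1 else 0 := by
  have h : ∀ y : Status Cond, y.isServing = true ↔ y = .serving := by
    intro y
    cases y <;> simp [Status.isServing]
  rw [numServing, Finset.card_filter, Fin.sum_univ_two]
  simp only [h]

theorem one_le_numServing_iff (z : Fin 2 → Status Cond) :
    1 ≤ numServing z ↔ z 0 = .serving ∨ z 1 = .serving := by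
  rw [numServing_fin_two]
  split_ifs <;> simp_all

theorem replenishment_allowed_iff (x : Fin 2 → Status Cond) (a : Fin 2 → Decision) :
    (replenishment m 1).allowed x a ↔
      ((x 0).after (a 0) = .serving → (x 1).after (a 1) = .serving →
        x 0 = .serving ∧ x 1 = .serving) := by
  have h : ∀ y : Status Cond, y.isServing = true ↔ y = .serving := by
    intro y
    cases y <;> simp [Status.isServing]
  have h' : ∀ y : Status Cond, y.isServing = false ↔ y ≠ .serving := by
    intro y
    cases y <;> simp [Status.isServing]
  simp only [replenishment, numServing_fin_two, afterAll, h, h', Fin.exists_fin_two]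
  by_cases h0 : (x 0).after (a 0) = .serving <;> by_cases h1 : (x 1).after (a 1) = .serving <;>
    simp [h0, h1]

theorem sum_replenishment_trans_mul (x : Fin 2 → Status Cond) (a : Fin 2 → Decision)
    (V : Status Cond → Status Cond → ℝ) :
    ∑ y, (replenishment m 1).trans x a y * V (y 0) (y 1) =
      (m 0).expNext ((x 0).after (a 0)) fun y0 =>
        (m 1).expNext ((x 1).after (a 1)) fun y1 => V y0 y1 := by
  rw [← Equiv.sum_comp (finTwoArrowEquiv (Status Cond)).symm, Fintype.sum_prod_type]
  simp only [← Machine.sum_step_mul, Finset.mul_sum]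
  refine Finset.sum_congr rfl fun y0 _ => Finset.sum_congr rfl fun y1 _ => ?_
  simp [replenishment, Fin.prod_univ_two, mul_assoc]

theorem replenishment_reward (x : Fin 2 → Status Cond) (a : Fin 2 → Decision) :
    (replenishment m 1).reward x a =
      (m 0).slotReward (x 0) (a 0) + (m 1).slotReward (x 1) (a 1) := by
  simp [replenishment, Fin.sum_univ_two]

theorem step_ne_zero_of_replenishment_trans {x y : Fin 2 → Status Cond} {a : Fin 2 → Decision}
    (h : (replenishment m 1).trans x a y ≠ 0) :
    (m 0).step ((x 0).after (a 0)) (y 0) ≠ 0 ∧ (m 1).step ((x 1).after (a 1)) (y 1) ≠ 0 := by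
  simpa [replenishment, Fin.prod_univ_two] using h

/-- The status of both machines lies in the recurrent class of the Whittle index policies. -/
def IsWhittleRecurrent : Status Cond → Status Cond → Prop
  | .active _, .active _ => True
  | .serving, .active .broken => True
  | _, _ => False

/-- The decisions taken by the Whittle index policies on their recurrent class. -/
def whittleRule : Status Cond → Status Cond → Decision × Decision
  | .serving, _ => (.keep, .keep)
  | _, .serving => (.keep, .keep)
  | _, .waiting => (.keep, .repair)
  | .waiting, _ => (.repair, .keep)
  | _, .active .broken => (.keep, .repair)
  | .active .broken, _ => (.repair, .keep)
  | _, _ => (.keep, .keep)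

/-- Whittle policies are constrained after every history, so existence needs a valid choice even in
states that are never reached, such as those with waiting machines. -/
theorem isWhittleAction_whittleRule (hG0 : (m 0).whittleIndex .good < 0)
    (hG1 : (m 1).whittleIndex .good < 0) (hB0 : 0 ≤ (m 0).whittleIndex .broken)
    (hB : (m 0).whittleIndex .broken < (m 1).whittleIndex .broken) (x : Fin 2 → Status Cond) :
    IsWhittleAction m 1 x ![(whittleRule (x 0) (x 1)).1, (whittleRule (x 0) (x 1)).2] := by
  have hB1 := hB0.trans hB.le
  have h01 := (hG0.trans_le hB1).le
  have h10 := (hG1.trans_le hB0).le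
  obtain ⟨x0, x1, rfl⟩ : ∃ x0 x1, x = ![x0, x1] := ⟨x 0, x 1, by
    funext i
    fin_cases i <;> rfl⟩
  rcases x0 with (_ | _) | _ | _ <;> rcases x1 with (_ | _) | _ | _ <;> constructor <;>
    simp [replenishment_allowed_iff, one_le_numServing_iff, Fin.forall_fin_two, whittleRule,
      Status.after, afterAll, hG0, hG1, hB0, hB1, hB.le, h01, h10]

/-- Negative indices forbid repairing good machines, the ban on idling forces a repair when one is
useful and possible, and the strict inequality settles the state with both broken, so no tie
matters. While the first machine is being served its own decision is not determined, but it has no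
effect. -/
theorem IsWhittleAction.after_eq (hG0 : (m 0).whittleIndex .good < 0)
    (hG1 : (m 1).whittleIndex .good < 0) (hB0 : 0 ≤ (m 0).whittleIndex .broken)
    (hB : (m 0).whittleIndex .broken < (m 1).whittleIndex .broken) {x : Fin 2 → Status Cond}
    {a : Fin 2 → Decision} (h : IsWhittleAction m 1 x a) (hx : IsWhittleRecurrent (x 0) (x 1)) :
    (x 0 = .serving ∨ a 0 = (whittleRule (x 0) (x 1)).1) ∧
      a 1 = (whittleRule (x 0) (x 1)).2 := by
  have hB1 := hB0.trans hB.le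
  obtain ⟨ha, he, hn, hh, hi, -, -⟩ := h
  rw [replenishment_allowed_iff] at ha
  simp only [Fin.forall_fin_two, one_le_numServing_iff, afterAll] at he hn hh hi
  generalize x 0 = x0 at *
  generalize x 1 = x1 at *
  generalize a 0 = a0 at *
  generalize a 1 = a1 at *
  rcases x0 with (_ | _) | _ | _ <;> rcases x1 with (_ | _) | _ | _ <;>
    simp [IsWhittleRecurrent] at hx <;> cases a0 <;> cases a1 <;>
    simp_all [whittleRule, Status.after, not_le.2]

end TwoMachines

/-! ### The instance and its indices -/

section Gap

variable {n : ℕ} (hn : 2 ≤ n)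

theorem gapMachines_zero_eq : ∃ hq0 hq1 hs0 hs1,
    gapMachines n hn 0 = twoStateMachine (1 / n) (1 / n ^ 4) hq0 hq1 hs0 hs1 := by
  have h1 : (1 : ℝ) ≤ n := by exact_mod_cast (by omega : 1 ≤ n)
  exact ⟨by positivity, (div_le_one (by linarith)).2 h1, by positivity,
    (div_le_one (by positivity)).2 (one_le_pow₀ h1), rfl⟩

theorem gapMachines_one_eq : ∃ hq0 hq1 hs0 hs1,
    gapMachines n hn 1 = twoStateMachine 1 1 hq0 hq1 hs0 hs1 :=
  ⟨zero_le_one, le_rfl, zero_lt_one, le_rfl, rfl⟩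

theorem gapMachines_zero_whittleIndex_good : (gapMachines n hn 0).whittleIndex .good < 0 := by
  have hn' : (0 : ℝ) < n := by exact_mod_cast (by omega : 0 < n)
  obtain ⟨hq0, hq1, hs0, hs1, h⟩ := gapMachines_zero_eq hn
  rw [h]
  refine lt_of_le_of_lt (whittleIndex_good_le _ _ hq0 hq1 hs0 hs1 (by positivity)) ?_
  exact_mod_cast (by norm_num : (-1 : ℝ) < 0)

theorem gapMachines_one_whittleIndex_good : (gapMachines n hn 1).whittleIndex .good < 0 := by
  obtain ⟨hq0, hq1, hs0, hs1, h⟩ := gapMachines_one_eq hn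
  rw [h]
  refine lt_of_le_of_lt (whittleIndex_good_le _ _ hq0 hq1 hs0 hs1 (by positivity)) ?_
  exact_mod_cast (by norm_num : (-1 : ℝ) < 0)

theorem gapMachines_zero_whittleIndex_broken :
    (gapMachines n hn 0).whittleIndex .broken = ((1 / n ^ 4 / (1 / n) : ℝ) : EReal) := by
  have hn' : (0 : ℝ) < n := by exact_mod_cast (by omega : 0 < n)
  obtain ⟨hq0, hq1, hs0, hs1, h⟩ := gapMachines_zero_eq hn
  rw [h, whittleIndex_broken _ _ hq0 hq1 hs0 hs1 (by positivity)]

theorem gapMachines_one_whittleIndex_broken :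
    (gapMachines n hn 1).whittleIndex .broken = ((1 / 1 : ℝ) : EReal) := by
  obtain ⟨hq0, hq1, hs0, hs1, h⟩ := gapMachines_one_eq hn
  rw [h, whittleIndex_broken _ _ hq0 hq1 hs0 hs1 (by positivity)]

theorem gapMachines_zero_whittleIndex_broken_nonneg :
    0 ≤ (gapMachines n hn 0).whittleIndex .broken := by
  rw [gapMachines_zero_whittleIndex_broken]
  exact_mod_cast (by positivity : (0 : ℝ) ≤ 1 / n ^ 4 / (1 / n))

theorem gapMachines_whittleIndex_broken_lt :
    (gapMachines n hn 0).whittleIndex .broken < (gapMachines n hn 1).whittleIndex .broken := by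
  have hn' : (1 : ℝ) < n := by exact_mod_cast (by omega : 1 < n)
  rw [gapMachines_zero_whittleIndex_broken, gapMachines_one_whittleIndex_broken,
    EReal.coe_lt_coe_iff]
  have h0 : (0 : ℝ) < n := by linarith
  have : (1 / n ^ 4 / (1 / n) : ℝ) = 1 / n ^ 3 := by field_simp
  rw [this]
  have := one_lt_pow₀ hn' (n := 3) (by norm_num)
  exact one_div_lt_one_div_of_lt one_pos this

/-- The reward of a slot with status `z`. -/
def earning : Status Cond → ℝ
  | .active .good => 1
  | _ => 0

/-- The expectation of `f` over the next status of a two-state machine. -/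
def nextValue (q s : ℝ) : Status Cond → (Status Cond → ℝ) → ℝ
  | .active .good, f => (1 - q) * f (.active .good) + q * f (.active .broken)
  | .active .broken, f => f (.active .broken)
  | .waiting, f => f .waiting
  | .serving, f => s * f (.active .good) + (1 - s) * f .serving

theorem gapMachines_reward_add_sum (x : Fin 2 → Status Cond) (a : Fin 2 → Decision)
    (V : Status Cond → Status Cond → ℝ) :
    (replenishment (gapMachines n hn) 1).reward x a +
        ∑ y, (replenishment (gapMachines n hn) 1).trans x a y * V (y 0) (y 1) =
      earning ((x 0).after (a 0)) + earning ((x 1).after (a 1)) +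
        nextValue (1 / n) (1 / n ^ 4) ((x 0).after (a 0)) fun y0 =>
          nextValue 1 1 ((x 1).after (a 1)) fun y1 => V y0 y1 := by
  have hr : ∀ (q s : ℝ) (hq0 hq1 hs0 hs1) (y : Status Cond) (d : Decision),
      (twoStateMachine q s hq0 hq1 hs0 hs1).slotReward y d = earning (y.after d) := by
    intro q s hq0 hq1 hs0 hs1 y d
    rcases y with (_ | _) | _ | _ <;> cases d <;>
      simp [Machine.slotReward, earning, Status.after, twoStateMachine]
  have he : ∀ (q s : ℝ) (hq0 hq1 hs0 hs1) (z : Status Cond) (f : Status Cond → ℝ),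
      (twoStateMachine q s hq0 hq1 hs0 hs1).expNext z f = nextValue q s z f := by
    intro q s hq0 hq1 hs0 hs1 z f
    rcases z with (_ | _) | _ | _ <;>
      simp [Machine.expNext, nextValue, Cond.sum_eq, twoStateMachine]
  rw [sum_replenishment_trans_mul, replenishment_reward]
  simp only [gapMachines, Matrix.cons_val_zero, Matrix.cons_val_one, hr, he]

/-! ### The optimal value -/

/-- A potential for the optimality equation with average reward `1 / 2`. -/
noncomputable def gapPotential (n : ℝ) : Status Cond → Status Cond → ℝ
  | .active .good, .active .good => n + 1 / 2
  | .active .good, _ => n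
  | .serving, .active .good => n + 1 - n ^ 4 / 2
  | .serving, .serving => n + 1 / 2
  | .serving, _ => n - n ^ 4 / 2
  | _, .active .good => 1 / 2
  | _, _ => 0

/-- In `gapPotential` a good first machine is worth its expected `n` remaining good slots, and a
good second machine `1 / 2`. A running repair of the first machine is worth the future `n` minus `1
/ 2` for each of the expected `n ^ 4` blocked slots; since `n ^ 4 ≥ 8 * n`, starting it never pays.
The state with both in service cannot arise from the initial state, but the inequality is needed
there too. -/
theorem gapMachines_upperAverage_le (π : (replenishment (gapMachines n hn) 1).Policy)
    (x : Fin 2 → Status Cond) :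
    (replenishment (gapMachines n hn) 1).upperAverage π x ≤ 1 / 2 := by
  have hn' : (2 : ℝ) ≤ n := by exact_mod_cast hn
  refine MDP.upperAverage_le _ π (fun y => gapPotential n (y 0) (y 1)) _ ?_ x
  intro x a ha
  rw [replenishment_allowed_iff] at ha
  rw [gapMachines_reward_add_sum]
  generalize x 0 = x0 at *
  generalize x 1 = x1 at *
  generalize a 0 = a0 at *
  generalize a 1 = a1 at *
  have h3 : (8 : ℝ) ≤ n ^ 3 := by
    have := pow_le_pow_left₀ (by norm_num) hn' 3
    linarith
  have h4 : 8 * (n : ℝ) ≤ n ^ 4 := by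
    have := mul_le_mul_of_nonneg_right h3 (by linarith : (0 : ℝ) ≤ n)
    linarith [pow_succ (n : ℝ) 3]
  have hp : 1 / (n : ℝ) * n = 1 := by field_simp
  have hs : 1 / (n : ℝ) ^ 4 * n ^ 4 = 1 := by field_simp
  have hs0 : 0 < 1 / (n : ℝ) ^ 4 := by positivity
  have hs1 : 1 / (n : ℝ) ^ 4 ≤ 1 := by
    rw [div_le_one (by positivity)]
    linarith
  -- With `p * n = 1` and `s * n ^ 4 = 1` recorded, the reciprocals become atoms and every case is
  -- linear.
  generalize 1 / (n : ℝ) ^ 4 = s at *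
  generalize 1 / (n : ℝ) = p at *
  rcases x0 with (_ | _) | _ | _ <;> rcases x1 with (_ | _) | _ | _ <;>
    cases a0 <;> cases a1 <;> simp [Status.after] at ha <;>
    simp only [Status.after, earning, nextValue, gapPotential] <;> linarith

/-- Never repair the first machine, and repair the second one whenever it is broken. -/
def repairSecond (x : Fin 2 → Status Cond) : Fin 2 → Decision :=
  ![.keep, if x 0 = .serving ∨ x 1 = .active .good then .keep else .repair]

theorem allowed_repairSecond (m : Fin 2 → Machine Cond) (x : Fin 2 → Status Cond) :
    (replenishment m 1).allowed x (repairSecond x) := by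
  rw [replenishment_allowed_iff]
  simp only [repairSecond, Matrix.cons_val_zero, Matrix.cons_val_one]
  generalize x 0 = x0 at *
  generalize x 1 = x1 at *
  rcases x0 with (_ | _) | _ | _ <;> rcases x1 with (_ | _) | _ | _ <;> simp [Status.after]

/-- Both machines stay active at slot boundaries, and there the potential of the upper bound
satisfies its inequality with equality under this policy. -/
theorem gapMachines_hasAverage_repairSecond :
    (replenishment (gapMachines n hn) 1).HasAverage
      ((replenishment (gapMachines n hn) 1).stationary repairSecond (allowed_repairSecond _))
      (allInitial (gapMachines n hn)) (1 / 2) := by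
  have hn' : (0 : ℝ) < n := by exact_mod_cast (by omega : 0 < n)
  refine MDP.hasAverage_stationary _ _ _ (fun x => ∃ u v, x 0 = .active u ∧ x 1 = .active v)
    (fun y => gapPotential n (y 0) (y 1)) _ ?_ ?_ ⟨_, _, rfl, rfl⟩
  · rintro x y ⟨u, v, hu, hv⟩ h
    obtain ⟨h0, h1⟩ := step_ne_zero_of_replenishment_trans h
    obtain ⟨hq0, hq1, hs0, hs1, he⟩ := gapMachines_one_eq hn
    rw [he] at h1
    simp only [repairSecond, hu, hv, Matrix.cons_val_zero, Matrix.cons_val_one] at h0 h1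
    generalize y 0 = y0 at *
    generalize y 1 = y1 at *
    cases y0 <;> cases v <;> cases y1 <;>
      simp_all [Status.after, Machine.step, twoStateMachine]
  · rintro x ⟨u, v, hu, hv⟩
    rw [gapMachines_reward_add_sum]
    simp only [repairSecond, hu, hv, Matrix.cons_val_zero, Matrix.cons_val_one]
    have hp : 1 / (n : ℝ) * n = 1 := by field_simp
    generalize 1 / (n : ℝ) = p at *
    cases u <;> cases v <;>
      simp [Status.after, earning, nextValue, gapPotential] <;> linarith

theorem gapMachines_optimalAverage :
    (replenishment (gapMachines n hn) 1).optimalAverage (allInitial (gapMachines n hn)) =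
      1 / 2 := by
  have h := gapMachines_hasAverage_repairSecond hn
  have : Nonempty (replenishment (gapMachines n hn) 1).Policy :=
    ⟨(replenishment (gapMachines n hn) 1).stationary _ (allowed_repairSecond _)⟩
  refine le_antisymm (ciSup_le fun π => gapMachines_upperAverage_le hn π _) ?_
  refine le_trans h.limsup_eq.ge (le_ciSup (f := fun π =>
    (replenishment (gapMachines n hn) 1).upperAverage π (allInitial (gapMachines n hn)))
    ⟨1 / 2, ?_⟩ _)
  rintro _ ⟨π, rfl⟩
  exact gapMachines_upperAverage_le hn π _

/-! ### The average of the Whittle index policies -/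

theorem exists_isWhittlePolicy_gapMachines :
    ∃ π : (replenishment (gapMachines n hn) 1).Policy,
      IsWhittlePolicy (gapMachines n hn) 1 π := by
  have h := isWhittleAction_whittleRule (gapMachines_zero_whittleIndex_good hn)
    (gapMachines_one_whittleIndex_good hn) (gapMachines_zero_whittleIndex_broken_nonneg hn)
    (gapMachines_whittleIndex_broken_lt hn)
  refine ⟨(replenishment (gapMachines n hn) 1).stationary _ fun x => (h x).allowed, ?_⟩
  intro l x a h0
  have ha : a = ![(whittleRule (x 0) (x 1)).1, (whittleRule (x 0) (x 1)).2] := by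
    by_contra hne
    simp [MDP.stationary, hne] at h0
  rw [ha]
  exact h x

/-- The time-average reward of the Whittle index policies when the first machine breaks with
probability `p` and its repair ends with probability `s`. -/
noncomputable def whittleAverage (p s : ℝ) : ℝ :=
  (3 - p ^ 2) / (2 - p ^ 2 + p * (2 - p) / s)

/-- The relative values of the Whittle index policies on their recurrent class. -/
noncomputable def whittlePotential (p s : ℝ) : Status Cond → Status Cond → ℝ
  | .active .good, .active .good =>
      2 - whittleAverage p s + p * (1 - whittleAverage p s / s - whittleAverage p s)
  | .active .broken, .active .good => 1 - whittleAverage p s / s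
  | .active .broken, .active .broken => 1 - whittleAverage p s / s - whittleAverage p s
  | .serving, .active .broken => -(whittleAverage p s / s)
  | _, _ => 0

/-- This is the evaluation equation at (good, broken), where `whittlePotential` is normalised to
`0`. Between visits to that state the expected reward is `3 - p ^ 2` and the expected time `2 - p ^
2 + p * (2 - p) / s`; their ratio is the average. -/
theorem whittleAverage_eq {p s : ℝ} (hp0 : 0 < p) (hp1 : p ≤ 1) (hs : 0 < s) :
    whittleAverage p s = 1 + (1 - p) * (2 - whittleAverage p s +
      p * (1 - whittleAverage p s / s - whittleAverage p s)) +
        p * (1 - whittleAverage p s / s) := by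
  have h : 0 < 2 - p ^ 2 + p * (2 - p) / s := by
    have : 0 < p * (2 - p) / s := div_pos (mul_pos hp0 (by linarith)) hs
    nlinarith
  have hw : whittleAverage p s * (2 - p ^ 2 + p * (2 - p) / s) = 3 - p ^ 2 :=
    div_mul_cancel₀ _ h.ne'
  have h1 : whittleAverage p s * (p * (2 - p) / s) =
      p * (2 - p) * (whittleAverage p s / s) := by ring
  rw [mul_add, h1] at hw
  linarith

/-- The class is closed: a repair of the second machine ends within its slot, so it is never seen in
service, and a repair of the first starts only from (broken, good), in a slot in which the second
breaks. The decisions are forced on the class, so history and randomization play no role. -/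
theorem IsWhittlePolicy.hasAverage_gapMachines
    {π : (replenishment (gapMachines n hn) 1).Policy}
    (hπ : IsWhittlePolicy (gapMachines n hn) 1 π) :
    (replenishment (gapMachines n hn) 1).HasAverage π (allInitial (gapMachines n hn))
      (whittleAverage (1 / n) (1 / n ^ 4)) := by
  have hn' : (1 : ℝ) ≤ n := by exact_mod_cast (by omega : 1 ≤ n)
  have hn0 : (0 : ℝ) < n := by linarith
  have hrule : ∀ h x a, IsWhittleRecurrent (x 0) (x 1) → π.prob h x a ≠ 0 →
      (x 0).after (a 0) = (x 0).after (whittleRule (x 0) (x 1)).1 ∧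
        (x 1).after (a 1) = (x 1).after (whittleRule (x 0) (x 1)).2 := by
    intro h x a hx h0
    obtain ⟨h1 | h1, h2⟩ := (hπ h x a h0).after_eq (gapMachines_zero_whittleIndex_good hn)
      (gapMachines_one_whittleIndex_good hn) (gapMachines_zero_whittleIndex_broken_nonneg hn)
      (gapMachines_whittleIndex_broken_lt hn) hx
    · simp [h1, h2, Status.after]
    · simp [h1, h2]
  refine MDP.hasAverage_of_potential _ π (fun x => IsWhittleRecurrent (x 0) (x 1))
    (fun y => whittlePotential (1 / n) (1 / n ^ 4) (y 0) (y 1)) _ ?_ ?_ trivial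
  · intro h x a y hx h0 hy
    obtain ⟨hy0, hy1⟩ := step_ne_zero_of_replenishment_trans hy
    obtain ⟨h1, h2⟩ := hrule h x a hx h0
    obtain ⟨hq0, hq1, hs0, hs1, he⟩ := gapMachines_one_eq hn
    rw [h1] at hy0
    rw [h2, he] at hy1
    clear h1 h2 h0 hy
    generalize x 0 = x0 at *
    generalize x 1 = x1 at *
    generalize y 0 = y0 at *
    generalize y 1 = y1 at *
    rcases x0 with (_ | _) | _ | _ <;> rcases x1 with (_ | _) | _ | _ <;>
      simp only [IsWhittleRecurrent] at hx <;>
      rcases y0 with _ | _ | _ <;> rcases y1 with (_ | _) | _ | _ <;>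
      simp [IsWhittleRecurrent, whittleRule, Status.after, Machine.step,
        twoStateMachine] at hy0 hy1 ⊢
  · intro h x a hx h0
    rw [gapMachines_reward_add_sum, (hrule h x a hx h0).1, (hrule h x a hx h0).2]
    clear h0
    generalize x 0 = x0 at *
    generalize x 1 = x1 at *
    have hp0 : 0 < 1 / (n : ℝ) := by positivity
    have hp1 : 1 / (n : ℝ) ≤ 1 := (div_le_one hn0).2 hn'
    have hs : 0 < 1 / (n : ℝ) ^ 4 := by positivity
    generalize 1 / (n : ℝ) ^ 4 = s at *
    generalize 1 / (n : ℝ) = p at *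
    have hw := whittleAverage_eq hp0 hp1 hs
    have hws : s * (whittleAverage p s / s) = whittleAverage p s := mul_div_cancel₀ _ hs.ne'
    rcases x0 with (_ | _) | _ | _ <;> rcases x1 with (_ | _) | _ | _ <;>
      simp only [IsWhittleRecurrent] at hx <;>
      simp only [whittleRule, Status.after, earning, nextValue, whittlePotential] <;> linarith

theorem whittleAverage_gap_bounds (hn : 2 ≤ n) : 0 < whittleAverage (1 / n) (1 / n ^ 4) ∧
    whittleAverage (1 / n) (1 / n ^ 4) ≤ 3 / (n : ℝ) ^ 3 := by
  have hn' : (1 : ℝ) ≤ n := by exact_mod_cast (by omega : 1 ≤ n)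
  have hn0 : (0 : ℝ) < n := by linarith
  have hp0 : 0 < 1 / (n : ℝ) := by positivity
  have hp1 : 1 / (n : ℝ) ≤ 1 := (div_le_one hn0).2 hn'
  -- The blocking term alone is at least `n ^ 3`, while the numerator is at most `3`; hence the
  -- constant `3`.
  have hd : 1 / (n : ℝ) * (2 - 1 / n) / (1 / n ^ 4) = n ^ 3 * (2 - 1 / n) := by field_simp
  have h3 : (n : ℝ) ^ 3 ≤ n ^ 3 * (2 - 1 / n) :=
    le_mul_of_one_le_right (by positivity) (by linarith)
  have hp2 : (1 / (n : ℝ)) ^ 2 ≤ 1 := pow_le_one₀ hp0.le hp1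
  have h3' : (0 : ℝ) < n ^ 3 := by positivity
  rw [whittleAverage, hd]
  constructor
  · exact div_pos (by linarith) (by linarith)
  · exact div_le_div₀ (by norm_num) (by linarith [sq_nonneg (1 / (n : ℝ))]) h3' (by linarith)

end Gap
theorem mainTheorem5 :
    (∃ C : ℝ, 0 < C ∧ ∀ (n : ℕ) (hn : 2 ≤ n),
      (replenishment (gapMachines n hn) 1).optimalAverage (allInitial (gapMachines n hn)) = 1 / 2 ∧
      (∃ π : (replenishment (gapMachines n hn) 1).Policy,
        (replenishment (gapMachines n hn) 1).HasAverage π (allInitial (gapMachines n hn)) (1 / 2)) ∧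
      (∃ π : (replenishment (gapMachines n hn) 1).Policy,
        IsWhittlePolicy (gapMachines n hn) 1 π) ∧
      ∀ π : (replenishment (gapMachines n hn) 1).Policy, IsWhittlePolicy (gapMachines n hn) 1 π →
        ∃ w : ℝ, (replenishment (gapMachines n hn) 1).HasAverage π
            (allInitial (gapMachines n hn)) w ∧
          0 < w ∧ w ≤ C / (n : ℝ) ^ 3) ∧
    (∀ α : ℝ, ∃ (n : ℕ) (hn : 2 ≤ n), ∀ π : (replenishment (gapMachines n hn) 1).Policy,
      IsWhittlePolicy (gapMachines n hn) 1 π →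
        α * (replenishment (gapMachines n hn) 1).upperAverage π (allInitial (gapMachines n hn)) <
          (replenishment (gapMachines n hn) 1).optimalAverage (allInitial (gapMachines n hn))) := by

  refine ⟨⟨3, by norm_num, fun n hn => ⟨gapMachines_optimalAverage hn,
    ⟨_, gapMachines_hasAverage_repairSecond hn⟩, exists_isWhittlePolicy_gapMachines hn,
    fun π hπ => ⟨_, hπ.hasAverage_gapMachines hn, whittleAverage_gap_bounds hn⟩⟩⟩, fun α => ?_⟩
  -- The goal `|α| * (3 / N ^ 3) < 1 / 2` amounts to `6 * |α| < N ^ 3`, and `N ≤ N ^ 3`; the shift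
  -- to `k + 2` secures `2 ≤ n`.
  obtain ⟨k, hk⟩ := exists_nat_gt (6 * |α|)
  have hn : 2 ≤ k + 2 := by omega
  refine ⟨k + 2, hn, fun π hπ => ?_⟩
  obtain ⟨hpos, hle⟩ := whittleAverage_gap_bounds hn
  rw [gapMachines_optimalAverage, MDP.upperAverage,
    Tendsto.limsup_eq (hπ.hasAverage_gapMachines hn)]
  generalize whittleAverage (1 / ((k + 2 : ℕ) : ℝ)) (1 / ((k + 2 : ℕ) : ℝ) ^ 4) = w at *
  have hk2 : 6 * |α| < ((k + 2 : ℕ) : ℝ) := by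
    push_cast
    linarith
  have h1 : (1 : ℝ) ≤ ((k + 2 : ℕ) : ℝ) := by exact_mod_cast (by omega : 1 ≤ k + 2)
  generalize ((k + 2 : ℕ) : ℝ) = N at *
  have h3 : N ≤ N ^ 3 := le_self_pow₀ h1 (by norm_num)
  calc α * w ≤ |α| * w := mul_le_mul_of_nonneg_right (le_abs_self α) hpos.le
    _ ≤ |α| * (3 / N ^ 3) := mul_le_mul_of_nonneg_left hle (abs_nonneg α)
    _ < 1 / 2 := by
      rw [← mul_div_assoc, div_lt_div_iff₀ (by linarith) (by norm_num)]
      linarith
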